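/- Let $d\ge 2$ be an integer, let $p>1$ and $h>0$ be real, and put $g(x)=(x^+)^p-x$. Let $b:\mathbb R^d\to\mathbb R^d$ be given by $$b_1(U)=\tfrac{2}{h^2}(-U_1+U_2),\qquad b_i(U)=\tfrac1{h^2}(U_{i+1}-2U_i+U_{i-1})\ \ (2\le i\le d-1),\qquad b_d(U)=\tfrac2{h^2}\bigl(-U_d+U_{d-1}+h\,g(U_d)\bigr).$$ For $u\in\mathbb R^d$ let $U^u$ be the maximal solution of $\dot U=b(U)$, $U(0)=u$, and let $\tau_0^u\in(0,\infty]$ be its explosion time. Let $D_e=\{u\in\mathbb R^d:\tau_0^u<\infty\}$ be the domain of explosion. For $\varepsilon>0$ let $U^{u,\varepsilon}$ be a solution up to its explosion time of $dU=b(U)\,dt+\varepsilon\,dW$, $U(0)=u$, where $W$ is a standard $d$-dimensional Brownian motion with respect to a filtration satisfying the usual conditions, on some probability space. That is, $U^{u,\varepsilon}$ is an adapted process with almost surely continuous paths in the one-point compactification $\mathbb R^d\cup\{\infty\}$ such that, with $\tau^n=\inf\{t\ge0:|U^{u,\varepsilon}(t)|\ge n\}$ (where $|\infty|=\infty$), for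 every $n\ge1$, almost surely for all $t\ge0$, $$U^{u,\varepsilon}(t\wedge\tau^n)=u+\int_0^{t\wedge\tau^n}b(U^{u,\varepsilon}(s))\,ds+\varepsilon W(t\wedge\tau^n),$$ with the integrand integrable on $[0,t\wedge\tau^n]$, and such that almost surely $U^{u,\varepsilon}(t)=\infty$ for all finite $t\ge\tau_\varepsilon^u:=\lim_n\tau^n$. The time $\tau_\varepsilon^u\in[0,\infty]$ is the explosion time of $U^{u,\varepsilon}$, and $P_u$ denotes the underlying probability (all the probabilities below depend only on $u$ and $\varepsilon$). **Theorem.** Let $\delta>0$. 1. For every $u\in D_e$, $\displaystyle\lim_{\varepsilon\to0^+}P_u\bigl(|\tau_\varepsilon^u-\tau_0^u|>\delta\bigr)=0.$ 2. The convergence is exponentially fast: for every $u\in D_e$ there are constants $C_1,C_2>0$ (depending on $d,p,h,u,\delta$) such that for all $0<\varepsilon\le1$ $$P_u\bigl(|\tau_\varepsilon^u-\tau_0^u|>\delta\bigr)\le C_1e^{-C_2/\varepsilon^2}.$$ 3. The upper bound on the explosion time is uniform on compact sets: for every compact $\mathcal K\subset D_e$ there are constants $C_1,C_2>0$ (depending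 on $d,p,h,\mathcal K,\delta$) such that for all $0<\varepsilon\le1$ and all $u\in\mathcal K$ $$P_u\bigl(\tau_\varepsilon^u>\tau_0^u+\delta\bigr)\le C_1e^{-C_2/\varepsilon^2}.$$ -/

import Mathlib

open MeasureTheory ProbabilityTheory Filter Topology
open scoped NNReal ENNReal

namespace BlowUp

noncomputable section

/-- The phase space `ℝ^d` with its Euclidean norm. -/
abbrev State (d : ℕ) : Type := EuclideanSpace ℝ (Fin d)

/-- The reaction term `g(x) = (x⁺)^p - x`. -/
def reaction (p x : ℝ) : ℝ := (max x 0) ^ p - x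

/-- The coordinate with (zero-based) number `k`; it is `0` when there is no such coordinate. -/
def coord {d : ℕ} (U : State d) (k : ℕ) : ℝ := if hk : k < d then U ⟨k, hk⟩ else 0

/-- The drift of the discretized reaction-diffusion equation, for `d ≥ 2`.
Coordinates are numbered `0, …, d - 1`. -/
def drift (d : ℕ) (p h : ℝ) (U : State d) : State d :=
  WithLp.toLp 2 fun i : Fin d =>
    if (i : ℕ) = 0 then
      2 / h ^ 2 * (-U i + coord U 1)
    else if (i : ℕ) + 1 = d then
      2 / h ^ 2 * (-U i + coord U (i - 1) + h * reaction p (U i))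
    else
      1 / h ^ 2 * (coord U (i + 1) - 2 * U i + coord U (i - 1))

/-- The finite value of a point of `ℝ^d ∪ {∞}`; the value at `∞` is a dummy. -/
def finitePart {d : ℕ} (z : OnePoint (State d)) : State d := z.elim 0 id

/-- The first time at which a path in `ℝ^d ∪ {∞}` has norm at least `n`
(`∞` counts as having infinite norm); it is `⊤` if there is no such time. -/
def levelTime {d : ℕ} (x : ℝ≥0 → OnePoint (State d)) (n : ℕ) : ℝ≥0∞ :=
  ⨅ (t : ℝ≥0) (_ : ∀ y : State d, x t = (y : OnePoint (State d)) → (n : ℝ) ≤ ‖y‖), (t : ℝ≥0∞)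

/-- The explosion time: the limit, which is the supremum, of the nondecreasing sequence
of level times. -/
def explosionTime {d : ℕ} (x : ℝ≥0 → OnePoint (State d)) : ℝ≥0∞ := ⨆ n : ℕ, levelTime x n

/-- `x` is the solution of `x' = b(x)`, `x(0) = u`, up to its explosion time, continued by `∞`. -/
structure IsODESolution {d : ℕ} (b : State d → State d) (u : State d)
    (x : ℝ≥0 → OnePoint (State d)) : Prop where
  continuous : Continuous x
  init : x 0 = (u : OnePoint (State d))
  deriv : ∀ t : ℝ≥0, (t : ℝ≥0∞) < explosionTime x →
    HasDerivWithinAt (fun s : ℝ => finitePart (x s.toNNReal)) (b (finitePart (x t)))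
      (Set.Ici 0) (t : ℝ)
  absorbed : ∀ t : ℝ≥0, explosionTime x ≤ (t : ℝ≥0∞) → x t = OnePoint.infty

/-- The domain of explosion: initial data whose deterministic solution explodes in finite time. -/
def explosionDomain {d : ℕ} (b : State d → State d) : Set (State d) :=
  {u | ∃ x : ℝ≥0 → OnePoint (State d), IsODESolution b u x ∧ explosionTime x < ⊤}

/-- The usual conditions: the filtration is right-continuous and `𝓕 0` contains all null sets. -/
structure UsualConditions {Ω : Type*} {mΩ : MeasurableSpace Ω}
    (𝓕 : Filtration ℝ≥0 mΩ) (P : Measure Ω) : Prop where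
  rightContinuous : 𝓕.IsRightContinuous
  complete : ∀ s : Set Ω, P s = 0 → MeasurableSet[𝓕 0] s

/-- `W` is a standard `d`-dimensional Brownian motion with respect to the filtration `𝓕`. -/
structure IsBrownianMotion {Ω : Type*} {mΩ : MeasurableSpace Ω} {d : ℕ}
    (𝓕 : Filtration ℝ≥0 mΩ) (P : Measure Ω) (W : ℝ≥0 → Ω → State d) : Prop where
  component : ∀ i : Fin d, IsBrownianReal (fun t ω => W t ω i) P
  indep_components : iIndepFun (fun (i : Fin d) (ω : Ω) (t : ℝ≥0) => W t ω i) P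
  adapted : ∀ t : ℝ≥0, Measurable[𝓕 t] (W t)
  indep_increments : ∀ s t : ℝ≥0, s ≤ t →
    Indep (MeasurableSpace.comap (fun ω => W t ω - W s ω) inferInstance) (𝓕 s) P

/-- The time `t ∧ τⁿ`, where `τⁿ` is the `n`-th level time of the path `x`. -/
def stoppedTime {d : ℕ} (x : ℝ≥0 → OnePoint (State d)) (n : ℕ) (t : ℝ≥0) : ℝ≥0 :=
  (min (t : ℝ≥0∞) (levelTime x n)).toNNReal

/-- `X` is a solution up to its explosion time of `dX = b(X) dt + ε dW`, `X(0) = u`,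
with values in `ℝ^d ∪ {∞}`. For locally Lipschitz `b` such a solution is pathwise unique and
automatically has the strong Markov property, so that property is not listed as a requirement. -/
structure IsSDESolution {Ω : Type*} {mΩ : MeasurableSpace Ω} {d : ℕ} (b : State d → State d)
    (ε : ℝ) (u : State d) (𝓕 : Filtration ℝ≥0 mΩ) (P : Measure Ω) (W : ℝ≥0 → Ω → State d)
    (X : ℝ≥0 → Ω → OnePoint (State d)) : Prop where
  usual : UsualConditions 𝓕 P
  brownian : IsBrownianMotion 𝓕 P W
  adapted : ∀ t : ℝ≥0, @Measurable Ω (OnePoint (State d)) (𝓕 t) (borel _) (X t)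
  continuous : ∀ᵐ ω ∂P, Continuous fun t => X t ω
  integrable : ∀ n : ℕ, 1 ≤ n → ∀ t : ℝ≥0, ∀ᵐ ω ∂P,
    IntervalIntegrable (fun s : ℝ => b (finitePart (X s.toNNReal ω))) volume
      0 (stoppedTime (fun r => X r ω) n t : ℝ)
  equation : ∀ n : ℕ, 1 ≤ n → ∀ᵐ ω ∂P, ∀ t : ℝ≥0,
    X (stoppedTime (fun r => X r ω) n t) ω =
      ((u + (∫ s in (0 : ℝ)..(stoppedTime (fun r => X r ω) n t : ℝ),
          b (finitePart (X s.toNNReal ω)))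
        + ε • W (stoppedTime (fun r => X r ω) n t) ω : State d) : OnePoint (State d))
  absorbed : ∀ᵐ ω ∂P, ∀ t : ℝ≥0, explosionTime (fun r => X r ω) ≤ (t : ℝ≥0∞) →
    X t ω = OnePoint.infty

/-- The distance `|s - t|` between two times in `[0, ∞]` (subtraction in `ℝ≥0∞` is truncated). -/
def timeDist (s t : ℝ≥0∞) : ℝ≥0∞ := max (s - t) (t - s)

end

end BlowUp

/-!
The proof is pathwise. A path of the stochastic equation solves `V' = b(V + w)`, where `w = εW` and
`V = X - w`; the event to be estimated is contained in the event that `w` leaves a small ball before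
a fixed time, whose probability is exponentially small.

*Explosion of perturbed solutions.* Let the unperturbed solution started at `u₀` explode. Since the
drift grows linearly as long as the last coordinate is bounded above, the last coordinate exceeds
every level before the explosion (`exists_le_last_of_explosionTime_lt_top`). The coordinates stay
bounded below on bounded time intervals, uniformly over small perturbations, because the linear part
is cooperative and the nonlinearity is nonnegative (`exists_lower_bound`). Hence there is a level `M`
such that a perturbed solution whose last coordinate has reached `M` satisfies `z' ≥ c z ^ p` from
then on, and explodes within time `δ` (`false_of_superlinear`). Let `t₁` be a time at which the
unperturbed solution is well above `M`. By Grönwall's inequality solutions with nearby initial data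
and small perturbation are still close to it at `t₁` (`IsPerturbedSolution.exists_tracking`), so they
all explode in the window `(t₁, t₁ + δ]` (`exists_explosion_window`). The window also contains the
unperturbed explosion times of all nearby initial data, which gives both the lower and the upper
bound, and a finite cover makes the estimate uniform on compact sets
(`exists_timeDist_le_of_isCompact`).

*Size of the noise.* The Gaussian tail of `sup_{t ≤ T} ‖W t‖` comes from Doob's maximal inequality
for the submartingale `exp (l B)` of a coordinate `B` on dyadic grids, and continuity of the paths
(`IsBrownianMotion.measure_exists_lt_norm_le`).
-/

namespace BlowUp

/-! ### Level times and explosion times of paths -/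

section Paths

variable {d : ℕ} {x : ℝ≥0 → OnePoint (State d)}

@[simp] lemma finitePart_coe (y : State d) : finitePart (y : OnePoint (State d)) = y := rfl

lemma exists_of_lt_levelTime {n : ℕ} {t : ℝ≥0} (ht : (t : ℝ≥0∞) < levelTime x n) :
    ∃ y : State d, x t = y ∧ ‖y‖ < n := by
  by_contra! H
  exact absurd ht (not_lt.2 (iInf₂_le t H))

lemma coe_finitePart_of_lt_levelTime {n : ℕ} {t : ℝ≥0} (ht : (t : ℝ≥0∞) < levelTime x n) :
    (finitePart (x t) : OnePoint (State d)) = x t := by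
  obtain ⟨y, hy, -⟩ := exists_of_lt_levelTime ht
  simp [hy]

lemma norm_finitePart_lt {n : ℕ} {t : ℝ≥0} (ht : (t : ℝ≥0∞) < levelTime x n) :
    ‖finitePart (x t)‖ < n := by
  obtain ⟨y, hy, h⟩ := exists_of_lt_levelTime ht
  simpa [hy] using h

lemma levelTime_mono (x : ℝ≥0 → OnePoint (State d)) : Monotone (levelTime x) := by
  intro m n hmn
  refine le_iInf₂ fun t ht => iInf₂_le t fun y hy => ?_
  exact le_trans (by exact_mod_cast hmn) (ht y hy)

lemma lt_explosionTime_iff {a : ℝ≥0∞} : a < explosionTime x ↔ ∃ n, a < levelTime x n :=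
  lt_iSup_iff

lemma levelTime_le_explosionTime (n : ℕ) : levelTime x n ≤ explosionTime x := le_iSup _ n

/-- A continuous path that stays in a ball of radius `r < n` as long as it has not reached the
level `n` does not reach it at all: the norm cannot jump from `r` to `n`. -/
lemma lt_levelTime_of_bounded (hx : Continuous x) {n : ℕ} {r : ℝ} (hr : r < n) {T : ℝ≥0}
    (h0 : x 0 ∈ ((↑) : State d → OnePoint (State d)) '' Metric.closedBall 0 r)
    (h : ∀ t : ℝ≥0, t ≤ T → (t : ℝ≥0∞) < levelTime x n →
      x t ∈ ((↑) : State d → OnePoint (State d)) '' Metric.closedBall 0 r) :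
    (T : ℝ≥0∞) < levelTime x n := by
  by_contra! hT
  set S : Set ℝ≥0 := {t | ∀ y : State d, x t = y → (n : ℝ) ≤ ‖y‖} with hS
  have hSx : S = x ⁻¹' (((↑) : State d → OnePoint (State d)) '' Metric.ball 0 n)ᶜ := by
    ext t
    simp only [hS, Set.mem_ofPred_eq, Set.mem_preimage, Set.mem_compl_iff, Set.mem_image,
      Metric.mem_ball, dist_zero_right, not_exists, not_and]
    constructor
    · intro H y hy hxy
      exact absurd (H y hxy.symm) (not_le.2 hy)
    · intro H y hxy
      by_contra! hy
      exact H y hy hxy.symm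
  have hSc : IsClosed S := by
    rw [hSx]
    exact (OnePoint.isOpen_image_coe.2 Metric.isOpen_ball).isClosed_compl.preimage hx
  have hSn : S.Nonempty := by
    by_contra! hne
    have : levelTime x n = ⊤ := by
      simp only [levelTime, iInf_eq_top]
      intro t ht
      exact absurd (show t ∈ S from ht) (by simp [hne])
    simp [this] at hT
  have hmem : sInf S ∈ S := hSc.csInf_mem hSn (OrderBot.bddBelow S)
  have hlev : levelTime x n = (sInf S : ℝ≥0) := by
    refine le_antisymm (iInf₂_le _ hmem) (le_iInf₂ fun t ht => ?_)
    exact_mod_cast csInf_le (OrderBot.bddBelow S) (show t ∈ S from ht)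
  have hC : IsClosed (((↑) : State d → OnePoint (State d)) '' Metric.closedBall 0 r) :=
    OnePoint.isClosed_image_coe.2 ⟨Metric.isClosed_closedBall, isCompact_closedBall _ _⟩
  have hin : x (sInf S) ∈ ((↑) : State d → OnePoint (State d)) '' Metric.closedBall 0 r := by
    rcases eq_or_ne (sInf S) 0 with h0' | h0'
    · rwa [h0']
    · have hcl : sInf S ∈ closure (Set.Iio (sInf S)) := by
        rw [closure_Iio' ⟨0, pos_iff_ne_zero.2 h0'⟩]
        exact Set.mem_Iic.2 le_rfl
      have hsub : Set.Iio (sInf S) ⊆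
          x ⁻¹' (((↑) : State d → OnePoint (State d)) '' Metric.closedBall 0 r) := by
        intro t ht
        have h1 : (t : ℝ≥0∞) < levelTime x n := by
          rw [hlev]; exact_mod_cast ht
        exact h t (by exact_mod_cast (h1.trans_le hT).le) h1
      exact closure_minimal hsub (hC.preimage hx) hcl
  obtain ⟨y, hy, hxy⟩ := hin
  have := hmem y hxy.symm
  simp only [Metric.mem_closedBall, dist_zero_right] at hy
  linarith

lemma continuousOn_finitePart (hx : Continuous x) {T : ℝ≥0} (hT : (T : ℝ≥0∞) < explosionTime x) :
    ContinuousOn (fun s : ℝ => finitePart (x s.toNNReal)) (Set.Icc 0 T) := by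
  obtain ⟨n, hn⟩ := lt_explosionTime_iff.1 hT
  rw [OnePoint.isOpenEmbedding_coe.isInducing.continuousOn_iff]
  refine (hx.comp continuous_real_toNNReal).continuousOn.congr fun s hs => ?_
  refine coe_finitePart_of_lt_levelTime (n := n) (lt_of_le_of_lt ?_ hn)
  exact_mod_cast Real.toNNReal_le_iff_le_coe.2 hs.2

end Paths

/-! ### Perturbed solutions -/

/-- `x` is a solution, up to its explosion time, of the integral equation
`x(t) = u + ∫₀ᵗ b(x(s)) ds + w(t)` with a perturbation `w`, `w(0) = 0`. The equation is stated as a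
differential equation for `x - w`, which is differentiable even where `w` is not. -/
structure IsPerturbedSolution {d : ℕ} (b : State d → State d) (u : State d)
    (w : ℝ≥0 → State d) (x : ℝ≥0 → OnePoint (State d)) : Prop where
  continuous : Continuous x
  init : x 0 = (u : OnePoint (State d))
  noise_zero : w 0 = 0
  deriv : ∀ t : ℝ≥0, (t : ℝ≥0∞) < explosionTime x →
    HasDerivWithinAt (fun s : ℝ => finitePart (x s.toNNReal) - w s.toNNReal)
      (b (finitePart (x t))) (Set.Ici 0) (t : ℝ)

lemma IsODESolution.isPerturbedSolution {d : ℕ} {b : State d → State d} {u : State d}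
    {x : ℝ≥0 → OnePoint (State d)} (hx : IsODESolution b u x) :
    IsPerturbedSolution b u 0 x where
  continuous := hx.continuous
  init := hx.init
  noise_zero := rfl
  deriv t ht := by simpa using hx.deriv t ht

lemma stoppedTime_eq_of_lt {d : ℕ} {x : ℝ≥0 → OnePoint (State d)} {n : ℕ} {t : ℝ≥0}
    (ht : (t : ℝ≥0∞) < levelTime x n) : stoppedTime x n t = t := by
  simp [stoppedTime, min_eq_left ht.le]

/-- Almost every path of a solution of the stochastic equation solves the deterministic equation
perturbed by the path `εW`. -/
lemma IsSDESolution.ae_isPerturbedSolution {Ω : Type*} {mΩ : MeasurableSpace Ω} {d : ℕ}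
    {b : State d → State d} (hb : Continuous b) {ε : ℝ} {u : State d} {𝓕 : Filtration ℝ≥0 mΩ}
    {P : Measure Ω} {W : ℝ≥0 → Ω → State d} {X : ℝ≥0 → Ω → OnePoint (State d)}
    (hX : IsSDESolution b ε u 𝓕 P W X) :
    ∀ᵐ ω ∂P, IsPerturbedSolution b u (fun t => ε • W t ω) (fun t => X t ω) := by
  have hW0 : ∀ᵐ ω ∂P, W 0 ω = 0 := by
    have : ∀ᵐ ω ∂P, ∀ i : Fin d, W 0 ω i = 0 :=
      ae_all_iff.2 fun i => (hX.brownian.component i).toIsPreBrownianReal.eval_zero_ae_eq_zero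
    filter_upwards [this] with ω hω
    ext i
    simpa using hω i
  have heq : ∀ᵐ ω ∂P, ∀ n : ℕ, 1 ≤ n → ∀ t : ℝ≥0,
    X (stoppedTime (fun r => X r ω) n t) ω =
      ((u + (∫ s in (0 : ℝ)..(stoppedTime (fun r => X r ω) n t : ℝ),
          b (finitePart (X s.toNNReal ω)))
        + ε • W (stoppedTime (fun r => X r ω) n t) ω : State d) : OnePoint (State d)) := by
    refine ae_all_iff.2 fun n => ?_
    by_cases hn : 1 ≤ n
    · filter_upwards [hX.equation n hn] with ω hω _ using hω
    · exact .of_forall fun ω h => absurd h hn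
  filter_upwards [hX.continuous, hW0, heq] with ω hc h0 he
  refine ⟨hc, ?_, by simp [h0], ?_⟩
  · have := he 1 le_rfl 0
    simpa [stoppedTime, h0] using this
  · intro t ht
    obtain ⟨n, hn⟩ := lt_explosionTime_iff.1 ht
    replace hn : (t : ℝ≥0∞) < levelTime (fun r => X r ω) (n + 1) :=
      hn.trans_le (levelTime_mono _ n.le_succ)
    obtain ⟨T, htT, hT⟩ := ENNReal.lt_iff_exists_nnreal_btwn.1 hn
    have htT' : (t : ℝ) < T := by exact_mod_cast htT
    have hcont : ContinuousOn (fun s : ℝ => b (finitePart (X s.toNNReal ω))) (Set.Icc 0 T) :=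
      hb.comp_continuousOn
        (continuousOn_finitePart hc (hT.trans_le (levelTime_le_explosionTime _)))
    have hint : HasDerivWithinAt (fun s : ℝ => u + ∫ r in (0 : ℝ)..s, 
        b (finitePart (X r.toNNReal ω))) (b (finitePart (X t ω))) (Set.Icc 0 (T : ℝ)) t := by
      refine HasDerivWithinAt.const_add u ?_
      have := fact_iff.2 (show (t : ℝ) ∈ Set.Icc (0 : ℝ) T from ⟨t.2, htT'.le⟩)
      have h := intervalIntegral.integral_hasDerivWithinAt_right (a := 0) (b := (t : ℝ))
        (f := fun s : ℝ => b (finitePart (X s.toNNReal ω))) (s := Set.Icc 0 (T : ℝ))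
        (t := Set.Icc 0 (T : ℝ))
        ((hcont.mono (Set.Icc_subset_Icc_right htT'.le)).intervalIntegrable_of_Icc t.2)
        (hcont.stronglyMeasurableAtFilter_nhdsWithin measurableSet_Icc _)
        (hcont _ ⟨t.2, htT'.le⟩)
      simpa using h
    have hIcc : Set.Icc (0 : ℝ) T ∈ 𝓝[Set.Ici 0] (t : ℝ) := by
      rw [← Set.Ici_inter_Iic, Set.inter_comm]
      exact inter_mem (mem_nhdsWithin_of_mem_nhds (Iic_mem_nhds htT')) self_mem_nhdsWithin
    refine (hint.congr (fun s hs => ?_) ?_).mono_of_mem_nhdsWithin hIcc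
    · have hs' : ((s.toNNReal : ℝ≥0) : ℝ≥0∞) < levelTime (fun r => X r ω) (n + 1) :=
        lt_of_le_of_lt (by exact_mod_cast Real.toNNReal_le_iff_le_coe.2 hs.2) hT
      have := he (n + 1) (by lia) s.toNNReal
      rw [stoppedTime_eq_of_lt hs', Real.coe_toNNReal _ hs.1] at this
      simp [this]
    · have := he (n + 1) (by lia) t
      rw [stoppedTime_eq_of_lt hn] at this
      simp [this]

namespace IsPerturbedSolution

variable {d : ℕ} {b : State d → State d} {u : State d} {w : ℝ≥0 → State d}
  {x : ℝ≥0 → OnePoint (State d)}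

lemma hasDerivWithinAt_Ici (hx : IsPerturbedSolution b u w x) {t : ℝ} (h0 : 0 ≤ t)
    (ht : (t.toNNReal : ℝ≥0∞) < explosionTime x) :
    HasDerivWithinAt (fun s : ℝ => finitePart (x s.toNNReal) - w s.toNNReal)
      (b (finitePart (x t.toNNReal))) (Set.Ici t) t := by
  have := hx.deriv t.toNNReal ht
  rw [Real.coe_toNNReal _ h0] at this
  exact this.mono (Set.Ici_subset_Ici.2 h0)

lemma continuousOn (hx : IsPerturbedSolution b u w x) {T : ℝ≥0}
    (hT : (T : ℝ≥0∞) < explosionTime x) :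
    ContinuousOn (fun s : ℝ => finitePart (x s.toNNReal) - w s.toNNReal) (Set.Icc 0 T) := by
  intro s hs
  have := hx.deriv s.toNNReal
    (lt_of_le_of_lt (by exact_mod_cast Real.toNNReal_le_iff_le_coe.2 hs.2) hT)
  rw [Real.coe_toNNReal _ hs.1] at this
  exact this.continuousWithinAt.mono Set.Icc_subset_Ici_self

lemma toNNReal_lt {T : ℝ≥0} (hT : (T : ℝ≥0∞) < explosionTime x) {s : ℝ} (hs : s ≤ T) :
    (s.toNNReal : ℝ≥0∞) < explosionTime x :=
  lt_of_le_of_lt (by exact_mod_cast Real.toNNReal_le_iff_le_coe.2 hs) hT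

end IsPerturbedSolution

/-! ### Stability on compact time intervals before the explosion -/

/-- Up to a time `T` before the explosion of an unperturbed solution, all solutions with nearby
initial data and small perturbations stay within distance `1` of it; in particular they do not
explode by the time `T`. -/
lemma IsPerturbedSolution.exists_tracking {d : ℕ} {b : State d → State d}
    (hb : ∀ R : ℝ, ∃ K : ℝ≥0, LipschitzOnWith K b (Metric.closedBall 0 R))
    {u₀ : State d} {x₀ : ℝ≥0 → OnePoint (State d)} (hx₀ : IsPerturbedSolution b u₀ 0 x₀)
    {T : ℝ≥0} (hT : (T : ℝ≥0∞) < explosionTime x₀) :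
    ∃ ρ : ℝ, 0 < ρ ∧ ρ ≤ 1 ∧ ∀ (u : State d) (w : ℝ≥0 → State d) (x : ℝ≥0 → OnePoint (State d)),
      IsPerturbedSolution b u w x → dist u u₀ ≤ ρ → (∀ t ≤ T, ‖w t‖ ≤ ρ) →
      (T : ℝ≥0∞) < explosionTime x ∧
        ∀ t ≤ T, dist (finitePart (x t)) (finitePart (x₀ t)) ≤ 1 := by
  obtain ⟨N, hN⟩ := lt_explosionTime_iff.1 hT
  obtain ⟨K₀, hK₀⟩ := hb (N + 3)
  set K : ℝ≥0 := K₀ + 1 with hKdef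
  have hK : LipschitzOnWith K b (Metric.closedBall 0 (N + 3)) := hK₀.weaken (by simp [hKdef])
  have hKpos : (0 : ℝ) < K := by rw [hKdef]; positivity
  set ρ : ℝ := (2 * Real.exp (K * T))⁻¹ with hρ
  have hE : 1 ≤ Real.exp (K * T) := Real.one_le_exp (by positivity)
  have hρE : ρ * (2 * Real.exp (K * T)) = 1 := inv_mul_cancel₀ (by positivity)
  have hρ0 : 0 < ρ := by positivity
  have hρ1 : ρ ≤ 1 := by nlinarith
  refine ⟨ρ, hρ0, hρ1, fun u w x hx hu hw => ?_⟩
  have hnorm₀ : ∀ t ≤ T, ‖finitePart (x₀ t)‖ < N := fun t ht =>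
    norm_finitePart_lt (lt_of_le_of_lt (by exact_mod_cast ht) hN)
  have key : ∀ t ≤ T, (t : ℝ≥0∞) < levelTime x (N + 2) →
      dist (finitePart (x t)) (finitePart (x₀ t)) ≤ 1 := by
    intro t ht hlt
    have hexp : (t : ℝ≥0∞) < explosionTime x := hlt.trans_le (levelTime_le_explosionTime _)
    have hexp₀ : (t : ℝ≥0∞) < explosionTime x₀ := lt_of_le_of_lt (by exact_mod_cast ht) hT
    have hle : ∀ s : ℝ, s ∈ Set.Ico 0 (t : ℝ) → s.toNNReal ≤ t := fun s hs =>
      Real.toNNReal_le_iff_le_coe.2 hs.2.le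
    have hY : ∀ s : ℝ, s ∈ Set.Ico 0 (t : ℝ) → ‖finitePart (x s.toNNReal)‖ ≤ N + 2 := by
      intro s hs
      have := norm_finitePart_lt (lt_of_le_of_lt
        (show (s.toNNReal : ℝ≥0∞) ≤ t by exact_mod_cast hle s hs) hlt)
      push_cast at this
      exact this.le
    have hV : ∀ s : ℝ, s ∈ Set.Ico 0 (t : ℝ) →
        finitePart (x s.toNNReal) - w s.toNNReal ∈ Metric.closedBall (0 : State d) (N + 3) := by
      intro s hs
      rw [mem_closedBall_zero_iff]
      have h1 := norm_sub_le (finitePart (x s.toNNReal)) (w s.toNNReal)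
      have h2 := hw _ ((hle s hs).trans ht)
      have h3 := hY s hs
      linarith
    have hgron := dist_le_of_approx_trajectories_ODE_of_mem (v := fun _ => b) (K := K)
      (s := fun _ => Metric.closedBall (0 : State d) (N + 3)) (a := 0) (b := (t : ℝ))
      (f := fun s : ℝ => finitePart (x s.toNNReal) - w s.toNNReal)
      (f' := fun s => b (finitePart (x s.toNNReal)))
      (g := fun s : ℝ => finitePart (x₀ s.toNNReal))
      (g' := fun s => b (finitePart (x₀ s.toNNReal))) (εf := K * ρ) (εg := 0) (δ := ρ)
      (fun _ _ => hK) (hx.continuousOn hexp)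
      (fun s hs => hx.hasDerivWithinAt_Ici hs.1
        (IsPerturbedSolution.toNNReal_lt hexp hs.2.le))
      (fun s hs => ?_) hV
      (by simpa using hx₀.continuousOn hexp₀)
      (fun s hs => by
        simpa using hx₀.hasDerivWithinAt_Ici hs.1
          (IsPerturbedSolution.toNNReal_lt hexp₀ hs.2.le))
      (fun s hs => by simp)
      (fun s hs => by
        rw [mem_closedBall_zero_iff]
        have := hnorm₀ _ ((hle s hs).trans ht)
        linarith)
      (by simpa [hx.init, hx₀.init, hx.noise_zero] using hu)
      (t : ℝ) ⟨t.2, le_rfl⟩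
    · rw [sub_zero, add_zero, gronwallBound_of_K_ne_0 hKpos.ne', Real.toNNReal_coe,
        mul_div_cancel_left₀ _ hKpos.ne'] at hgron
      have hexple : Real.exp (K * t) ≤ Real.exp (K * T) :=
        Real.exp_le_exp.2 (mul_le_mul_of_nonneg_left (by exact_mod_cast ht) hKpos.le)
      have h1 : dist (finitePart (x t)) (finitePart (x t) - w t) ≤ ρ := by
        simpa [dist_eq_norm] using hw t ht
      have h2 := dist_triangle (finitePart (x t)) (finitePart (x t) - w t) (finitePart (x₀ t))
      nlinarith
    · have hmem : finitePart (x s.toNNReal) ∈ Metric.closedBall (0 : State d) (N + 3) := by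
        rw [mem_closedBall_zero_iff]
        have := hY s hs
        linarith
      refine (hK.dist_le_mul _ hmem _ (hV s hs)).trans
        (mul_le_mul_of_nonneg_left ?_ hKpos.le)
      simpa [dist_eq_norm] using hw _ ((hle s hs).trans ht)
  have h0 : x 0 ∈ ((↑) : State d → OnePoint (State d)) '' Metric.closedBall 0 (N + 1) := by
    refine ⟨u, ?_, hx.init.symm⟩
    have h1 := hnorm₀ 0 zero_le
    rw [hx₀.init, finitePart_coe] at h1
    rw [mem_closedBall_zero_iff]
    have h2 : ‖u‖ ≤ dist u u₀ + ‖u₀‖ := by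
      rw [dist_eq_norm]; simpa using norm_add_le (u - u₀) u₀
    linarith
  have hlev : (T : ℝ≥0∞) < levelTime x (N + 2) := by
    refine lt_levelTime_of_bounded hx.continuous (r := N + 1) (by push_cast; linarith) h0
      fun t ht hlt => ?_
    refine ⟨finitePart (x t), ?_, coe_finitePart_of_lt_levelTime hlt⟩
    rw [mem_closedBall_zero_iff]
    have h1 := hnorm₀ t ht
    have h2 := key t ht hlt
    rw [dist_eq_norm] at h2
    have h3 := norm_add_le (finitePart (x t) - finitePart (x₀ t)) (finitePart (x₀ t))
    rw [sub_add_cancel] at h3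
    linarith
  exact ⟨hlev.trans_le (levelTime_le_explosionTime _), fun t ht =>
    key t ht (lt_of_le_of_lt (by exact_mod_cast ht) hlev)⟩

/-! ### Estimates for the drift -/

section Drift

variable {d : ℕ} {p h : ℝ}

lemma abs_apply_le_norm (U : State d) (i : Fin d) : |U i| ≤ ‖U‖ := by
  simpa using PiLp.norm_apply_le U i

lemma norm_le_sum_abs (U : State d) : ‖U‖ ≤ ∑ i, |U i| := by
  rw [EuclideanSpace.norm_eq, Real.sqrt_le_left (Finset.sum_nonneg fun _ _ => abs_nonneg _)]
  simpa using Finset.sum_sq_le_sq_sum_of_nonneg (s := Finset.univ) (f := fun i => |U i|)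
    (fun _ _ => abs_nonneg _)

lemma norm_le_of_abs_apply_le {U : State d} {c : ℝ} (hU : ∀ i, |U i| ≤ c) : ‖U‖ ≤ d * c :=
  (norm_le_sum_abs U).trans <| by
    simpa using Finset.sum_le_card_nsmul Finset.univ (fun i => |U i|) c (fun i _ => hU i)

lemma abs_coord_le_norm (U : State d) (k : ℕ) : |coord U k| ≤ ‖U‖ := by
  unfold coord
  split_ifs
  · exact abs_apply_le_norm U _
  · simp

lemma coord_sub (U V : State d) (k : ℕ) : coord (U - V) k = coord U k - coord V k := by
  unfold coord
  split_ifs <;> simp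

lemma exists_abs_reaction_sub_le (hp : 1 < p) (R : ℝ) :
    ∃ L : ℝ, 0 ≤ L ∧ ∀ x y : ℝ, |x| ≤ R → |y| ≤ R →
      |reaction p x - reaction p y| ≤ L * |x - y| := by
  have hc : ContDiff ℝ 1 fun x : ℝ => x ^ p := by
    exact_mod_cast Real.contDiff_rpow_const_of_le (n := 1) (by exact_mod_cast hp.le)
  obtain ⟨K, hK⟩ := hc.contDiffOn.exists_lipschitzOnWith one_ne_zero (convex_Icc 0 |R|)
    isCompact_Icc
  refine ⟨K + 1, by positivity, fun x y hx hy => ?_⟩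
  have hmem : ∀ z : ℝ, |z| ≤ R → max z 0 ∈ Set.Icc 0 |R| := fun z hz =>
    ⟨le_max_right _ _, max_le ((le_abs_self z).trans (hz.trans (le_abs_self R))) (abs_nonneg R)⟩
  have h1 := hK.dist_le_mul _ (hmem x hx) _ (hmem y hy)
  simp only [Real.dist_eq] at h1
  have h2 : |max x 0 - max y 0| ≤ |x - y| := by simpa using abs_max_sub_max_le_max x 0 y 0
  calc |reaction p x - reaction p y|
      = |((max x 0) ^ p - (max y 0) ^ p) - (x - y)| := by unfold reaction; ring_nf
    _ ≤ |(max x 0) ^ p - (max y 0) ^ p| + |x - y| := abs_sub _ _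
    _ ≤ (K + 1) * |x - y| := by nlinarith [K.2, mul_le_mul_of_nonneg_left h2 K.2]

/-- The drift is Lipschitz on every ball. -/
lemma exists_lipschitzOnWith_drift (hp : 1 < p) (hh : 0 < h) (R : ℝ) :
    ∃ K : ℝ≥0, LipschitzOnWith K (drift d p h) (Metric.closedBall 0 R) := by
  obtain ⟨L, hL0, hL⟩ := exists_abs_reaction_sub_le hp R
  have hκ : 0 ≤ d * (2 / h ^ 2 * (2 + h * L)) := by positivity
  refine ⟨NNReal.mk _ hκ, LipschitzOnWith.of_dist_le_mul fun U hU V hV => ?_⟩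
  rw [mem_closedBall_zero_iff] at hU hV
  rw [dist_eq_norm, dist_eq_norm, NNReal.coe_mk, mul_assoc]
  refine norm_le_of_abs_apply_le fun i => ?_
  have hi : |U i - V i| ≤ ‖U - V‖ := by simpa using abs_apply_le_norm (U - V) i
  have hc : ∀ k, |coord U k - coord V k| ≤ ‖U - V‖ := fun k => by
    rw [← coord_sub]; exact abs_coord_le_norm _ k
  have hr : |reaction p (U i) - reaction p (V i)| ≤ L * ‖U - V‖ :=
    (hL _ _ ((abs_apply_le_norm U i).trans hU) ((abs_apply_le_norm V i).trans hV)).trans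
      (mul_le_mul_of_nonneg_left hi hL0)
  have hN := norm_nonneg (U - V)
  have hLN : 0 ≤ h * (L * ‖U - V‖) := by positivity
  have h2 : 0 < 2 / h ^ 2 := by positivity
  rw [PiLp.sub_apply]
  simp only [drift]
  rw [mul_assoc]
  split_ifs with h0 h1
  · rw [← mul_sub, abs_mul, abs_of_pos h2]
    refine mul_le_mul_of_nonneg_left ?_ h2.le
    have := hc 1
    rw [abs_le] at *
    constructor <;> linarith
  · rw [← mul_sub, abs_mul, abs_of_pos h2]
    refine mul_le_mul_of_nonneg_left ?_ h2.le
    have := hc (i - 1)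
    have hr' : |h * (reaction p (U i) - reaction p (V i))| ≤ h * (L * ‖U - V‖) := by
      rw [abs_mul, abs_of_pos hh]
      exact mul_le_mul_of_nonneg_left hr hh.le
    rw [abs_le] at *
    constructor <;> linarith
  · rw [← mul_sub, abs_mul, abs_of_pos (by positivity : 0 < 1 / h ^ 2),
      show 2 / h ^ 2 * ((2 + h * L) * ‖U - V‖) = 1 / h ^ 2 * (2 * ((2 + h * L) * ‖U - V‖)) by ring]
    refine mul_le_mul_of_nonneg_left ?_ (by positivity)
    have ha := hc (i - 1)
    have hb := hc (i + 1)
    rw [abs_le] at *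
    constructor <;> linarith

lemma continuous_drift (hp : 1 < p) (hh : 0 < h) : Continuous (drift d p h) := by
  refine continuous_iff_continuousAt.2 fun U => ?_
  obtain ⟨K, hK⟩ := exists_lipschitzOnWith_drift (d := d) hp hh (‖U‖ + 1)
  refine hK.continuousOn.continuousAt (Metric.closedBall_mem_nhds_of_mem ?_)
  simp

/-- As long as the last coordinate is bounded above, the drift grows at most linearly. -/
lemma exists_norm_drift_le (hp : 1 < p) (hh : 0 < h) (M : ℝ) :
    ∃ κ : ℝ, 0 ≤ κ ∧ ∀ U : State d, (∀ i : Fin d, (i : ℕ) + 1 = d → U i ≤ M) →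
      ‖drift d p h U‖ ≤ κ * ‖U‖ + κ := by
  set Q : ℝ := (max M 0) ^ p with hQ
  have hQ0 : 0 ≤ Q := Real.rpow_nonneg (le_max_right _ _) _
  refine ⟨d * (2 / h ^ 2 * (2 + h * (Q + 1))), by positivity, fun U hU => ?_⟩
  rw [← mul_add_one, mul_assoc]
  refine norm_le_of_abs_apply_le fun i => ?_
  have hi := abs_apply_le_norm U i
  have hc := abs_coord_le_norm U
  have hN := norm_nonneg U
  have h2 : 0 < 2 / h ^ 2 := by positivity
  have hhN : 0 ≤ h * (Q * ‖U‖) := by positivity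
  have hhQ : 0 ≤ h * Q := by positivity
  have hhU : 0 ≤ h * ‖U‖ := by positivity
  simp only [drift]
  rw [mul_assoc]
  split_ifs with h0 h1
  · rw [abs_mul, abs_of_pos h2]
    refine mul_le_mul_of_nonneg_left ?_ h2.le
    have := hc 1
    rw [abs_le] at *
    constructor <;> linarith
  · rw [abs_mul, abs_of_pos h2]
    refine mul_le_mul_of_nonneg_left ?_ h2.le
    have := hc (i - 1)
    have hr' : |h * reaction p (U i)| ≤ h * (Q + ‖U‖) := by
      rw [abs_mul, abs_of_pos hh]
      refine mul_le_mul_of_nonneg_left ((abs_sub _ _).trans (add_le_add ?_ hi)) hh.le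
      rw [abs_of_nonneg (Real.rpow_nonneg (le_max_right _ _) _)]
      exact Real.rpow_le_rpow (le_max_right _ _) (max_le_max (hU i h1) le_rfl) (by linarith)
    rw [abs_le] at *
    constructor <;> linarith
  · rw [abs_mul, abs_of_pos (by positivity : 0 < 1 / h ^ 2),
      show 2 / h ^ 2 * ((2 + h * (Q + 1)) * (‖U‖ + 1))
        = 1 / h ^ 2 * (2 * ((2 + h * (Q + 1)) * (‖U‖ + 1))) by ring]
    refine mul_le_mul_of_nonneg_left ?_ (by positivity)
    have ha := hc (i - 1)
    have hb := hc (i + 1)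
    rw [abs_le] at *
    constructor <;> linarith

/-- Quasi-monotonicity at the bottom: the drift in a coordinate that is at most `1` is bounded
below in terms of a lower bound of all the coordinates. -/
lemma neg_le_drift_apply (hh : 0 < h) {U : State d} {i : Fin d} (hi : U i ≤ 1) {S : ℝ}
    (hS : 0 ≤ S) (hU : ∀ j, -(S + 1) ≤ U j) :
    -(2 / h ^ 2 * (2 + h) * (S + 1)) ≤ drift d p h U i := by
  have hc : ∀ k, -(S + 1) ≤ coord U k := by
    intro k
    unfold coord
    split_ifs
    · exact hU _
    · linarith
  have h2 : 0 < 2 / h ^ 2 := by positivity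
  have hhS : 0 ≤ h * S := by positivity
  simp only [drift]
  split_ifs with h0 h1
  · rw [mul_assoc, ← mul_neg]
    refine mul_le_mul_of_nonneg_left ?_ h2.le
    linarith [hc 1]
  · rw [mul_assoc, ← mul_neg]
    refine mul_le_mul_of_nonneg_left ?_ h2.le
    have hr : h * (-1) ≤ h * reaction p (U i) := by
      refine mul_le_mul_of_nonneg_left ?_ hh.le
      have := Real.rpow_nonneg (le_max_right (U i) 0) p
      unfold reaction
      linarith
    linarith [hc (i - 1)]
  · rw [show -(2 / h ^ 2 * (2 + h) * (S + 1)) = 1 / h ^ 2 * (-(2 * ((2 + h) * (S + 1)))) by ring]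
    refine mul_le_mul_of_nonneg_left ?_ (by positivity)
    linarith [hc (i - 1), hc (i + 1)]

/-- A lower bound for the drift in the last coordinate, in terms of a lower bound for the
coordinate before it. -/
lemma le_drift_last (hd : 2 ≤ d) (hh : 0 < h) {U : State d} {i : Fin d} (hi : (i : ℕ) + 1 = d)
    {S : ℝ} (hU : ∀ j, -S ≤ U j) :
    2 / h ^ 2 * (h * (max (U i) 0) ^ p - (1 + h) * U i - S) ≤ drift d p h U i := by
  have h0 : (i : ℕ) ≠ 0 := by lia
  have hc : -S ≤ coord U (i - 1) := by
    unfold coord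
    rw [dif_pos (by lia)]
    exact hU _
  simp only [drift, h0, hi, if_true, if_false]
  refine mul_le_mul_of_nonneg_left ?_ (by positivity)
  unfold reaction
  linarith

end Drift

/-! ### Scalar differential inequalities -/

lemma hasDerivAt_max_zero_sq (a : ℝ) :
    HasDerivAt (fun x : ℝ => (max x 0) ^ 2) (2 * max a 0) a := by
  rcases lt_trichotomy a 0 with ha | rfl | ha
  · rw [max_eq_right ha.le, mul_zero]
    refine (hasDerivAt_const a (0 : ℝ)).congr_of_eventuallyEq ?_
    filter_upwards [Iio_mem_nhds ha] with x hx
    simp [max_eq_right (Set.mem_Iio.1 hx).le]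
  · rw [max_self, mul_zero, hasDerivAt_iff_isLittleO]
    refine Asymptotics.IsBigO.trans_isLittleO (g := fun x : ℝ => x ^ 2) ?_ ?_
    · refine Asymptotics.IsBigO.of_bound 1 (.of_forall fun x => ?_)
      simp only [max_self, sub_zero, smul_zero, ne_eq, OfNat.ofNat_ne_zero, not_false_eq_true,
        zero_pow, norm_pow, Real.norm_eq_abs, one_mul]
      refine pow_le_pow_left₀ (abs_nonneg _) ?_ 2
      simpa using abs_max_sub_max_le_max x 0 0 0
    · simpa using Asymptotics.isLittleO_pow_id (𝕜 := ℝ) one_lt_two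
  · rw [max_eq_left ha.le]
    have h := hasDerivAt_pow 2 a
    simp only [Nat.cast_ofNat, Nat.add_one_sub_one, pow_one] at h
    refine h.congr_of_eventuallyEq ?_
    filter_upwards [Ioi_mem_nhds ha] with x hx
    simp [max_eq_left (Set.mem_Ioi.1 hx).le]

/-- If each negative component of `V` decreases at a rate controlled by the sum of the negative
parts, then the components of `V` are bounded below. This is Grönwall's inequality for the sum of
the squared negative parts. -/
lemma neg_le_apply_of_neg_le_deriv {d : ℕ} {V V' : ℝ → State d} {T κ A : ℝ} (hκ : 0 ≤ κ)
    (hV : ContinuousOn V (Set.Icc 0 T))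
    (hV' : ∀ t ∈ Set.Ico 0 T, HasDerivWithinAt V (V' t) (Set.Ici t) t)
    (h0 : ‖V 0‖ ≤ A)
    (h : ∀ t ∈ Set.Ico 0 T, ∀ i, V t i < 0 → -(κ * (∑ j, max (-V t j) 0 + 1)) ≤ V' t i) :
    ∀ t ∈ Set.Icc 0 T, ∀ i,
      -(1 + gronwallBound (A ^ 2) (4 * κ * d) (2 * κ) T) ≤ V t i := by
  set E : ℝ → ℝ := fun t => ∑ i, (max (-V t i) 0) ^ 2 with hE
  have hcoord : ∀ t ∈ Set.Ico 0 T, ∀ i, HasDerivWithinAt (fun s => V s i) (V' t i) (Set.Ici t) t :=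
    fun t ht i =>
    (EuclideanSpace.proj (𝕜 := ℝ) i).hasFDerivAt.comp_hasDerivWithinAt t (hV' t ht)
  have hEd : ∀ t ∈ Set.Ico 0 T,
      HasDerivWithinAt E (∑ i, 2 * max (-V t i) 0 * (-V' t i)) (Set.Ici t) t := by
    intro t ht
    refine HasDerivWithinAt.fun_sum fun i _ => ?_
    exact (hasDerivAt_max_zero_sq (-V t i)).comp_hasDerivWithinAt t (hcoord t ht i).neg
  have hEc : ContinuousOn E (Set.Icc 0 T) := by
    refine continuousOn_finsetSum _ fun i _ => ?_
    have : ContinuousOn (fun t => V t i) (Set.Icc 0 T) :=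
      (EuclideanSpace.proj (𝕜 := ℝ) i).continuous.comp_continuousOn hV
    exact ((this.neg).sup continuousOn_const).pow 2
  have hE0 : E 0 ≤ A ^ 2 := by
    have h1 : E 0 ≤ ‖V 0‖ ^ 2 := by
      rw [EuclideanSpace.norm_sq_eq]
      refine Finset.sum_le_sum fun i _ => ?_
      refine pow_le_pow_left₀ (le_max_right _ _) (max_le ?_ (norm_nonneg _)) 2
      exact neg_le_abs _
    exact h1.trans (pow_le_pow_left₀ (norm_nonneg _) h0 2)
  have hbound : ∀ t ∈ Set.Ico 0 T, ∑ i, 2 * max (-V t i) 0 * (-V' t i)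
      ≤ 4 * κ * d * E t + 2 * κ := by
    intro t ht
    set S : ℝ := ∑ j, max (-V t j) 0 with hS
    have h1 : ∑ i, 2 * max (-V t i) 0 * (-V' t i) ≤ ∑ i, 2 * max (-V t i) 0 * (κ * (S + 1)) := by
      refine Finset.sum_le_sum fun i _ => ?_
      by_cases hi : V t i < 0
      · have hm : 0 ≤ max (-V t i) 0 := le_max_right _ _
        exact mul_le_mul_of_nonneg_left (by linarith [h t ht i hi]) (by positivity)
      · rw [max_eq_right (by linarith)]
        simp
    rw [← Finset.sum_mul, ← Finset.mul_sum, ← hS] at h1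
    have h2 : S ^ 2 ≤ d * E t := by
      simpa using sq_sum_le_card_mul_sum_sq (s := (Finset.univ : Finset (Fin d)))
        (f := fun i => max (-V t i) 0)
    nlinarith [sq_nonneg (S - 1), mul_le_mul_of_nonneg_left h2 hκ,
      mul_nonneg hκ (sq_nonneg (S - 1))]
  intro t ht i
  have hg := le_gronwallBound_of_liminf_deriv_right_le hEc
    (fun s hs r hr => (hEd s hs).liminf_right_slope_le hr) hE0 hbound t ht
  have hmono : gronwallBound (A ^ 2) (4 * κ * d) (2 * κ) (t - 0)
      ≤ gronwallBound (A ^ 2) (4 * κ * d) (2 * κ) T :=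
    gronwallBound_mono (by positivity) (by positivity) (by positivity) (by linarith [ht.2])
  have hi : (max (-V t i) 0) ^ 2 ≤ E t :=
    Finset.single_le_sum (f := fun i => (max (-V t i) 0) ^ 2) (fun _ _ => sq_nonneg _)
      (Finset.mem_univ i)
  nlinarith [le_max_left (-V t i) 0, sq_nonneg (max (-V t i) 0 - 1)]

/-- A superlinear differential inequality forces blow-up: a function that starts above `M` and
satisfies `z' ≥ c z ^ p` above `M` does not live for as long as `M ^ (1 - p) / ((p - 1) c)`. -/
lemma false_of_superlinear {z z' : ℝ → ℝ} {a b c M p : ℝ} (hab : a ≤ b) (hp : 1 < p) (hc : 0 < c)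
    (hM : 1 ≤ M) (hz : ContinuousOn z (Set.Icc a b))
    (hz' : ∀ t ∈ Set.Ico a b, HasDerivWithinAt z (z' t) (Set.Ici t) t) (ha : M ≤ z a)
    (h : ∀ t ∈ Set.Ico a b, M ≤ z t → c * z t ^ p ≤ z' t)
    (hlen : M ^ (1 - p) < (p - 1) * c * (b - a)) : False := by
  have hMz : ∀ t ∈ Set.Icc a b, M ≤ z t := by
    intro t ht
    have := image_le_of_deriv_right_lt_deriv_boundary (f := fun t => -z t) (f' := fun t => -z' t)
      (B := fun _ => -M) (B' := fun _ => 0) hz.neg (fun t ht => (hz' t ht).neg) (by simpa using ha)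
      (fun t => hasDerivAt_const t _) (fun t ht heq => ?_) ht
    · simpa using this
    · have h1 : z t = M := by simpa using heq
      have h2 := h t ht h1.ge
      have h3 : 0 < z t ^ p := Real.rpow_pos_of_pos (by linarith) p
      have : 0 < c * z t ^ p := by positivity
      linarith
  have hpos : ∀ t ∈ Set.Icc a b, 0 < z t := fun t ht => by linarith [hMz t ht]
  have hfin := image_le_of_deriv_right_le_deriv_boundary (f := fun t => z t ^ (1 - p))
    (f' := fun t => z' t * (1 - p) * z t ^ (1 - p - 1))
    (B := fun t => M ^ (1 - p) - (p - 1) * c * (t - a)) (B' := fun _ => -((p - 1) * c))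
    (a := a) (b := b)
    (hz.rpow_const fun t ht => Or.inl (hpos t ht).ne')
    (fun t ht => (hz' t ht).rpow_const (Or.inl (hpos t (Set.Ico_subset_Icc_self ht)).ne'))
    (by simpa using Real.rpow_le_rpow_of_nonpos (by linarith) ha (by linarith))
    (by fun_prop)
    (fun t ht => by
      simpa using ((((hasDerivAt_id t).sub_const a).const_mul ((p - 1) * c)).const_sub
        (M ^ (1 - p))).hasDerivWithinAt)
    (fun t ht => ?_) (Set.right_mem_Icc.2 hab)
  · have : 0 < z b ^ (1 - p) := Real.rpow_pos_of_pos (hpos b (Set.right_mem_Icc.2 hab)) _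
    linarith
  · have htI := Set.Ico_subset_Icc_self ht
    have h1 := h t ht (hMz t htI)
    have h2 : z t ^ p * z t ^ (1 - p - 1) = 1 := by
      rw [← Real.rpow_add (hpos t htI)]
      simp
    have h3 : 0 < z t ^ (1 - p - 1) := Real.rpow_pos_of_pos (hpos t htI) _
    have h4 : c ≤ z' t * z t ^ (1 - p - 1) := by
      have := mul_le_mul_of_nonneg_right h1 h3.le
      rw [mul_assoc, h2] at this
      linarith
    nlinarith

/-- A threshold above which the nonlinearity dominates linear terms and the remaining life time
of a blowing-up solution is short. -/
lemma exists_threshold {p c A δ : ℝ} (hp : 1 < p) (hc : 0 < c) (hδ : 0 < δ) :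
    ∃ M : ℝ, 1 ≤ M ∧ (∀ z, M ≤ z → A * z ≤ c * z ^ p) ∧ M ^ (1 - p) < δ := by
  have h1 : Tendsto (fun z : ℝ => z ^ (p - 1)) atTop atTop := tendsto_rpow_atTop (by linarith)
  have h2 : Tendsto (fun z : ℝ => z ^ (1 - p)) atTop (𝓝 0) := by
    simpa using tendsto_rpow_neg_atTop (show 0 < p - 1 by linarith)
  obtain ⟨M, hM⟩ := eventually_atTop.1 ((h1.eventually_ge_atTop (A / c)).and
    ((h2.eventually_lt_const hδ).and (eventually_ge_atTop 1)))
  refine ⟨M, (hM M le_rfl).2.2, fun z hz => ?_, (hM M le_rfl).2.1⟩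
  obtain ⟨ha, -, hz1⟩ := hM z hz
  rw [div_le_iff₀ hc] at ha
  have : z ^ p = z ^ (p - 1) * z := by
    rw [← Real.rpow_add_one (by linarith)]; simp
  rw [this]
  nlinarith

/-! ### Explosion of perturbed solutions -/

section Explosion

variable {d : ℕ} {p h : ℝ}

/-- On bounded time intervals the components of perturbed solutions are bounded below, uniformly
over bounded initial data and over perturbations bounded by `1`. -/
lemma exists_lower_bound (hh : 0 < h) (A : ℝ) (T : ℝ≥0) :
    ∃ R : ℝ, ∀ (u : State d) (w : ℝ≥0 → State d) (x : ℝ≥0 → OnePoint (State d)),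
      IsPerturbedSolution (drift d p h) u w x → ‖u‖ ≤ A →
      ∀ T' ≤ T, (T' : ℝ≥0∞) < explosionTime x → (∀ t ≤ T', ‖w t‖ ≤ 1) →
      ∀ t ≤ T', ∀ i, -R ≤ finitePart (x t) i := by
  set κ : ℝ := 2 / h ^ 2 * (2 + h) with hκ
  have hκ0 : 0 ≤ κ := by positivity
  refine ⟨1 + gronwallBound (A ^ 2) (4 * κ * d) (2 * κ) T + 1,
    fun u w x hx hu T' hT' hexp hw t ht i => ?_⟩
  have hwi : ∀ s ≤ T', ∀ j, |w s j| ≤ 1 := fun s hs j => (abs_apply_le_norm _ j).trans (hw s hs)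
  have hle : ∀ s : ℝ, s ≤ T' → s.toNNReal ≤ T' := fun s hs => Real.toNNReal_le_iff_le_coe.2 hs
  have hlow := neg_le_apply_of_neg_le_deriv
    (V := fun s : ℝ => finitePart (x s.toNNReal) - w s.toNNReal)
    (V' := fun s => drift d p h (finitePart (x s.toNNReal))) (T := T') (A := A) hκ0
    (hx.continuousOn hexp)
    (fun s hs => hx.hasDerivWithinAt_Ici hs.1 (IsPerturbedSolution.toNNReal_lt hexp hs.2.le))
    (by simpa [hx.init, hx.noise_zero] using hu)
    (fun s hs j hj => ?_) t ⟨t.2, by exact_mod_cast ht⟩ i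
  · have hmono : gronwallBound (A ^ 2) (4 * κ * d) (2 * κ) T'
        ≤ gronwallBound (A ^ 2) (4 * κ * d) (2 * κ) T :=
      gronwallBound_mono (by positivity) (by positivity) (by positivity) (by exact_mod_cast hT')
    have h1 := (abs_le.1 (hwi t ht i)).1
    simp only [Real.toNNReal_coe, PiLp.sub_apply] at hlow
    linarith
  · have hs' := hle s hs.2.le
    simp only [PiLp.sub_apply] at hj ⊢
    refine neg_le_drift_apply hh ?_ (Finset.sum_nonneg fun _ _ => le_max_right _ _) fun k => ?_
    · linarith [(abs_le.1 (hwi _ hs' j)).2]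
    · have h1 := Finset.single_le_sum (s := Finset.univ) (a := k)
        (f := fun k => max (-(finitePart (x s.toNNReal) k - w s.toNNReal k)) 0)
        (fun _ _ => le_max_right _ _) (Finset.mem_univ k)
      have h2 := le_max_left (-(finitePart (x s.toNNReal) k - w s.toNNReal k)) 0
      have h3 := (abs_le.1 (hwi _ hs' k)).1
      linarith

/-- If the unperturbed solution explodes in finite time, its last coordinate is unbounded above. -/
lemma exists_le_last_of_explosionTime_lt_top (hp : 1 < p) (hh : 0 < h) {u : State d}
    {x : ℝ≥0 → OnePoint (State d)} (hx : IsPerturbedSolution (drift d p h) u 0 x)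
    (hfin : explosionTime x < ⊤) (M : ℝ) :
    ∃ t : ℝ≥0, (t : ℝ≥0∞) < explosionTime x ∧
      ∃ i : Fin d, (i : ℕ) + 1 = d ∧ M ≤ finitePart (x t) i := by
  by_contra! H
  obtain ⟨κ, hκ0, hκ⟩ := exists_norm_drift_le (d := d) hp hh M
  set T : ℝ≥0 := (explosionTime x).toNNReal with hT
  have hTcoe : (T : ℝ≥0∞) = explosionTime x := ENNReal.coe_toNNReal hfin.ne
  have hmono := gronwallBound_mono (δ := ‖u‖) (K := κ) (ε := κ) (norm_nonneg u) hκ0 hκ0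
  obtain ⟨n, hn⟩ := exists_nat_gt (gronwallBound ‖u‖ κ κ T)
  have hlt : (T : ℝ≥0∞) < levelTime x n := by
    refine lt_levelTime_of_bounded hx.continuous hn ⟨u, ?_, hx.init.symm⟩ fun t ht hlt => ?_
    · rw [mem_closedBall_zero_iff]
      simpa [gronwallBound_x0] using hmono T.2
    · have hexp : (t : ℝ≥0∞) < explosionTime x := hlt.trans_le (levelTime_le_explosionTime _)
      refine ⟨finitePart (x t), ?_, coe_finitePart_of_lt_levelTime hlt⟩
      rw [mem_closedBall_zero_iff]
      have hg := norm_le_gronwallBound_of_norm_deriv_right_le (K := κ) (ε := κ) (δ := ‖u‖)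
        (f := fun s : ℝ => finitePart (x s.toNNReal))
        (f' := fun s => drift d p h (finitePart (x s.toNNReal)))
        (a := 0) (b := (t : ℝ)) (by simpa using hx.continuousOn hexp)
        (fun s hs => by
          simpa using hx.hasDerivWithinAt_Ici hs.1
            (IsPerturbedSolution.toNNReal_lt hexp hs.2.le))
        (by simp [hx.init])
        (fun s hs => hκ _ fun i hi => (H _
          (IsPerturbedSolution.toNNReal_lt hexp hs.2.le) i hi).le) t ⟨t.2, le_rfl⟩
      simp only [Real.toNNReal_coe, sub_zero] at hg
      exact hg.trans (hmono (by exact_mod_cast ht))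
  exact absurd (hlt.trans_le (levelTime_le_explosionTime _)) (by rw [hTcoe]; exact lt_irrefl _)

/-- Near an initial datum whose unperturbed solution explodes, all solutions with a sufficiently
small perturbation explode within a common time window of length `δ`. -/
lemma exists_explosion_window (hd : 2 ≤ d) (hp : 1 < p) (hh : 0 < h) {u₀ : State d}
    {x₀ : ℝ≥0 → OnePoint (State d)} (hx₀ : IsPerturbedSolution (drift d p h) u₀ 0 x₀)
    (hfin : explosionTime x₀ < ⊤) {δ : ℝ≥0} (hδ : 0 < δ) :
    ∃ ρ : ℝ, 0 < ρ ∧ ∃ t₁ T : ℝ≥0, ∀ (u : State d) (w : ℝ≥0 → State d)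
      (x : ℝ≥0 → OnePoint (State d)), IsPerturbedSolution (drift d p h) u w x → dist u u₀ ≤ ρ →
      (∀ t ≤ T, ‖w t‖ ≤ ρ) →
      (t₁ : ℝ≥0∞) < explosionTime x ∧ explosionTime x ≤ (t₁ + δ : ℝ≥0) := by
  have hδ' : (0 : ℝ) < δ := by exact_mod_cast hδ
  set T : ℝ≥0 := (explosionTime x₀).toNNReal + δ with hT
  obtain ⟨R, hR⟩ := exists_lower_bound (d := d) (p := p) hh (‖u₀‖ + 1) T
  -- Above the level `M`, half of the nonlinear boundary term dominates all other terms.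
  obtain ⟨M, hM1, hMdom, hMlen⟩ := exists_threshold (c := h / 2) (A := (1 + h) * 3 + |R|)
    (δ := (p - 1) * (1 / h) * δ) hp (by positivity)
    (mul_pos (mul_pos (by linarith) (by positivity)) hδ')
  obtain ⟨t₁, ht₁, i, hi, hMi⟩ := exists_le_last_of_explosionTime_lt_top hp hh hx₀ hfin (M + 3)
  obtain ⟨ρ, hρ0, hρ1, hρ⟩ := hx₀.exists_tracking
    (exists_lipschitzOnWith_drift (d := d) hp hh) ht₁
  have ht₁T : t₁ + δ ≤ T := by
    have : t₁ ≤ (explosionTime x₀).toNNReal := by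
      rw [← ENNReal.coe_le_coe, ENNReal.coe_toNNReal hfin.ne]
      exact ht₁.le
    exact add_le_add_left this δ
  refine ⟨ρ, hρ0, t₁, T, fun u w x hx hu hw => ?_⟩
  obtain ⟨hexp₁, htrack⟩ := hρ u w x hx hu fun t ht =>
    hw t (ht.trans (le_self_add.trans ht₁T))
  refine ⟨hexp₁, ?_⟩
  by_contra! hexp
  have hle : ∀ s : ℝ, s ≤ ((t₁ + δ : ℝ≥0) : ℝ) → s.toNNReal ≤ t₁ + δ :=
    fun s hs => Real.toNNReal_le_iff_le_coe.2 hs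
  have hw1 : ∀ t ≤ t₁ + δ, ‖w t‖ ≤ 1 := fun t ht => (hw t (ht.trans ht₁T)).trans hρ1
  have hwi : ∀ t ≤ t₁ + δ, |w t i| ≤ 1 := fun t ht => (abs_apply_le_norm _ i).trans (hw1 t ht)
  have hnu : ‖u‖ ≤ ‖u₀‖ + 1 := by
    rw [dist_eq_norm] at hu
    have := norm_add_le (u - u₀) u₀
    rw [sub_add_cancel] at this
    linarith
  have hlow := hR u w x hx hnu _ ht₁T hexp hw1
  have hnonneg : ∀ s : ℝ, (t₁ : ℝ) ≤ s → 0 ≤ s := fun s hs => t₁.2.trans hs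
  refine false_of_superlinear (z := fun s : ℝ => finitePart (x s.toNNReal) i - w s.toNNReal i - 1)
    (z' := fun s => drift d p h (finitePart (x s.toNNReal)) i) (a := t₁) (b := (t₁ + δ : ℝ≥0))
    (c := 1 / h) (M := M) (p := p) (by simp) hp (by positivity) hM1 ?_ ?_ ?_ ?_ ?_
  · have h1 := (hx.continuousOn hexp).mono (Set.Icc_subset_Icc_left t₁.2)
    have h2 := (EuclideanSpace.proj (𝕜 := ℝ) i).continuous.comp_continuousOn h1
    exact h2.sub continuousOn_const
  · intro s hs
    have h1 := hx.hasDerivWithinAt_Ici (hnonneg s hs.1)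
      (IsPerturbedSolution.toNNReal_lt hexp hs.2.le)
    exact ((EuclideanSpace.proj (𝕜 := ℝ) i).hasFDerivAt.comp_hasDerivWithinAt s h1).sub_const 1
  · have h1 := htrack t₁ le_rfl
    rw [dist_eq_norm] at h1
    have h2 := abs_le.1 ((abs_apply_le_norm _ i).trans h1)
    have h3 := abs_le.1 (hwi t₁ le_self_add)
    simp only [PiLp.sub_apply] at h2
    simp only [Real.toNNReal_coe]
    linarith [h2.1, h3.2]
  · intro s hs hMs
    have hs' := hle s hs.2.le
    have hw' := abs_le.1 (hwi _ hs')
    set y : ℝ := finitePart (x s.toNNReal) i with hy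
    set z : ℝ := y - w s.toNNReal i - 1 with hz
    have hz1 : 1 ≤ z := hM1.trans hMs
    have hdrift := le_drift_last (p := p) hd hh hi (S := |R|) fun j =>
      (neg_le_neg (le_abs_self R)).trans (hlow _ hs' j)
    rw [← hy] at hdrift
    have hyz : z ≤ max y 0 := le_max_of_le_left (by linarith [hw'.1])
    have hpow : z ^ p ≤ (max y 0) ^ p := Real.rpow_le_rpow (by linarith) hyz (by linarith)
    have hpow' := mul_le_mul_of_nonneg_left hpow hh.le
    have hdom := hMdom z hMs
    have hRz : |R| ≤ |R| * z := le_mul_of_one_le_right (abs_nonneg R) hz1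
    have hyle : (1 + h) * y ≤ (1 + h) * (3 * z) :=
      mul_le_mul_of_nonneg_left (by linarith [hw'.2]) (by positivity)
    refine le_trans ?_ hdrift
    have hkey : h / 2 * z ^ p ≤ h * (max y 0) ^ p - (1 + h) * y - |R| := by linarith
    calc 1 / h * z ^ p = 2 / h ^ 2 * (h / 2 * z ^ p) := by field_simp
      _ ≤ _ := mul_le_mul_of_nonneg_left hkey (by positivity)
  · simpa using hMlen

/-- On a compact set of exploding initial data, perturbations that are small up to a common time
move the explosion time by at most `δ`. -/
lemma exists_timeDist_le_of_isCompact (hd : 2 ≤ d) (hp : 1 < p) (hh : 0 < h)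
    {K : Set (State d)} (hK : IsCompact K) (hKD : K ⊆ explosionDomain (drift d p h))
    {δ : ℝ} (hδ : 0 < δ) :
    ∃ ρ : ℝ, 0 < ρ ∧ ∃ T : ℝ≥0, ∀ u ∈ K, ∀ (w : ℝ≥0 → State d)
      (x₀ x : ℝ≥0 → OnePoint (State d)), IsODESolution (drift d p h) u x₀ →
      IsPerturbedSolution (drift d p h) u w x → (∀ t ≤ T, ‖w t‖ ≤ ρ) →
      timeDist (explosionTime x) (explosionTime x₀) ≤ ENNReal.ofReal δ := by
  refine hK.induction_on ⟨1, one_pos, 0, by simp⟩ ?_ ?_ ?_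
  · rintro s t hst ⟨ρ, hρ, T, H⟩
    exact ⟨ρ, hρ, T, fun u hu => H u (hst hu)⟩
  · rintro s t ⟨ρ, hρ, T, H⟩ ⟨ρ', hρ', T', H'⟩
    refine ⟨min ρ ρ', lt_min hρ hρ', max T T', ?_⟩
    rintro u (hu | hu) w x₀ x hx₀ hx hw
    · exact H u hu w x₀ x hx₀ hx fun r hr =>
        (hw r (hr.trans (le_max_left _ _))).trans (min_le_left _ _)
    · exact H' u hu w x₀ x hx₀ hx fun r hr =>
        (hw r (hr.trans (le_max_right _ _))).trans (min_le_right _ _)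
  · intro u₀ hu₀
    obtain ⟨y, hy, hyfin⟩ := hKD hu₀
    obtain ⟨ρ, hρ, t₁, T, H⟩ := exists_explosion_window hd hp hh hy.isPerturbedSolution hyfin
      (Real.toNNReal_pos.2 hδ)
    refine ⟨Metric.closedBall u₀ ρ,
      mem_nhdsWithin_of_mem_nhds (Metric.closedBall_mem_nhds _ hρ), ρ, hρ, T, ?_⟩
    intro u hu w x₀ x hx₀ hx hw
    -- Both explosion times lie in the window, since `w = 0` is an admissible perturbation.
    obtain ⟨h1, h2⟩ := H u w x hx hu hw
    obtain ⟨h3, h4⟩ := H u 0 x₀ hx₀.isPerturbedSolution hu fun t _ => by simpa using hρ.le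
    rw [ENNReal.coe_add] at h2 h4
    refine max_le (tsub_le_iff_left.2 (h2.trans ?_)) (tsub_le_iff_left.2 (h4.trans ?_))
    · exact add_le_add_left h3.le _
    · exact add_le_add_left h1.le _

end Explosion

/-! ### Exponential maximal inequality for Brownian motion -/

section Brownian

variable {Ω : Type*} {mΩ : MeasurableSpace Ω} {P : Measure Ω}
  {𝓕 : Filtration ℝ≥0 mΩ} {B : ℝ≥0 → Ω → ℝ}

lemma integrable_exp_mul_of_hasLaw {Y : Ω → ℝ} {v : ℝ≥0} (hY : HasLaw Y (gaussianReal 0 v) P)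
    (l : ℝ) : Integrable (fun ω => Real.exp (l * Y ω)) P := by
  have h := integrable_exp_mul_gaussianReal (μ := 0) (v := v) l
  rw [← hY.map_eq] at h
  exact h.comp_aemeasurable hY.aemeasurable

lemma integral_exp_mul_of_hasLaw {Y : Ω → ℝ} {v : ℝ≥0} (hY : HasLaw Y (gaussianReal 0 v) P)
    (l : ℝ) : ∫ ω, Real.exp (l * Y ω) ∂P = Real.exp (v * l ^ 2 / 2) := by
  simpa [mgf] using mgf_gaussianReal hY.map_eq l

lemma submartingale_exp_mul [IsProbabilityMeasure P] (hB : IsPreBrownianReal B P)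
    (hadp : ∀ t, Measurable[𝓕 t] (B t))
    (hind : ∀ s t : ℝ≥0, s ≤ t →
      Indep (MeasurableSpace.comap (fun ω => B t ω - B s ω) inferInstance) (𝓕 s) P) (l : ℝ) :
    Submartingale (fun t ω => Real.exp (l * B t ω)) 𝓕 P := by
  have hsm : ∀ t, StronglyMeasurable[𝓕 t] (fun ω => Real.exp (l * B t ω)) := fun t =>
    (Real.measurable_exp.comp ((hadp t).const_mul l)).stronglyMeasurable
  have hint : ∀ t, Integrable (fun ω => Real.exp (l * B t ω)) P := fun t =>
    integrable_exp_mul_of_hasLaw (hB.hasLaw_eval t) l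
  refine ⟨hsm, fun s t hst => ?_, hint⟩
  have hfac : (fun ω => Real.exp (l * B t ω)) =
      (fun ω => Real.exp (l * B s ω)) * fun ω => Real.exp (l * (B t ω - B s ω)) := by
    ext ω
    rw [Pi.mul_apply, ← Real.exp_add]
    ring_nf
  have hlaw : HasLaw (fun ω => B t ω - B s ω) _ P := hB.hasLaw_sub t s
  have hincr := integrable_exp_mul_of_hasLaw hlaw l
  have hmeas : Measurable (fun ω => B t ω - B s ω) :=
    ((hadp t).mono (𝓕.le t) le_rfl).sub ((hadp s).mono (𝓕.le s) le_rfl)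
  have h1 := condExp_mul_of_stronglyMeasurable_left (μ := P) (hsm s) (hfac ▸ hint t) hincr
  have h2 : P[fun ω => Real.exp (l * (B t ω - B s ω)) | 𝓕 s]
      =ᵐ[P] fun _ => ∫ ω, Real.exp (l * (B t ω - B s ω)) ∂P := by
    refine condExp_indep_eq hmeas.comap_le (𝓕.le s) ?_ (hind s t hst)
    exact (Real.measurable_exp.comp
      ((comap_measurable (fun ω => B t ω - B s ω)).const_mul l)).stronglyMeasurable
  change (fun ω => Real.exp (l * B s ω)) ≤ᵐ[P] P[fun ω => Real.exp (l * B t ω) | 𝓕 s]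
  rw [hfac]
  filter_upwards [h1, h2] with ω hω1 hω2
  rw [hω1, Pi.mul_apply, hω2, integral_exp_mul_of_hasLaw hlaw]
  exact le_mul_of_one_le_right (Real.exp_pos _).le (Real.one_le_exp (by positivity))

/-- Doob's maximal inequality for the exponential submartingale, along a finite grid of times. -/
lemma measure_grid_le [IsProbabilityMeasure P] (hB : IsPreBrownianReal B P)
    (hadp : ∀ t, Measurable[𝓕 t] (B t))
    (hind : ∀ s t : ℝ≥0, s ≤ t →
      Indep (MeasurableSpace.comap (fun ω => B t ω - B s ω) inferInstance) (𝓕 s) P)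
    {l : ℝ} (hl : 0 ≤ l) (a : ℝ) {g : ℕ → ℝ≥0} (hg : Monotone g) (n : ℕ) :
    P {ω | ∃ k ≤ n, a < B (g k) ω} ≤ ENNReal.ofReal (Real.exp (g n * l ^ 2 / 2 - l * a)) := by
  have hsub := submartingale_exp_mul hB hadp hind l
  have hsub' : Submartingale (fun k ω => Real.exp (l * B (g k) ω))
      (⟨fun k => 𝓕 (g k), fun i j hij => 𝓕.mono (hg hij), fun k => 𝓕.le _⟩ : Filtration ℕ mΩ) P :=
    ⟨fun k => hsub.1 (g k), fun i j hij => hsub.2.1 _ _ (hg hij), fun k => hsub.2.2 _⟩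
  have hmax := maximal_ineq hsub' (fun k ω => (Real.exp_pos _).le)
    (ε := (Real.exp (l * a)).toNNReal) n
  rw [Real.coe_toNNReal _ (Real.exp_pos _).le] at hmax
  have hle : ENNReal.ofReal (Real.exp (l * a)) * P {ω | ∃ k ≤ n, a < B (g k) ω}
      ≤ ENNReal.ofReal (Real.exp (g n * l ^ 2 / 2)) := by
    refine le_trans (mul_le_mul_right (measure_mono ?_) _) (hmax.trans (ENNReal.ofReal_le_ofReal ?_))
    · rintro ω ⟨k, hk, hak⟩
      refine le_trans ?_ (Finset.le_sup' (fun k => Real.exp (l * B (g k) ω))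
        (Finset.mem_range.2 (Nat.lt_succ_of_le hk)))
      exact Real.exp_le_exp.2 (mul_le_mul_of_nonneg_left hak.le hl)
    · rw [← integral_exp_mul_of_hasLaw (hB.hasLaw_eval (g n)) l]
      exact setIntegral_le_integral (hsub.2.2 _) (.of_forall fun ω => (Real.exp_pos _).le)
  rw [Real.exp_sub, ENNReal.ofReal_div_of_pos (Real.exp_pos _)]
  rw [mul_comm] at hle
  exact (ENNReal.le_div_iff_mul_le (Or.inl (by simp [Real.exp_pos]))
    (Or.inl ENNReal.ofReal_ne_top)).2 hle

/-- The grid estimate passes to all times by refining dyadic grids and continuity of the paths. -/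
lemma measure_exists_lt_le [IsProbabilityMeasure P] (hB : IsBrownianReal B P)
    (hadp : ∀ t, Measurable[𝓕 t] (B t))
    (hind : ∀ s t : ℝ≥0, s ≤ t →
      Indep (MeasurableSpace.comap (fun ω => B t ω - B s ω) inferInstance) (𝓕 s) P)
    {T : ℝ≥0} (hT : 0 < T) {a : ℝ} (ha : 0 ≤ a) :
    P {ω | ∃ t ≤ T, a < B t ω} ≤ ENNReal.ofReal (Real.exp (-(a ^ 2 / (2 * T)))) := by
  have hT' : (0 : ℝ) < T := by exact_mod_cast hT
  set G : ℕ → Set Ω := fun n => {ω | ∃ k : ℕ, k ≤ 2 ^ n ∧ a < B (k * (T / 2 ^ n)) ω} with hG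
  have hGmono : Monotone G := by
    refine monotone_nat_of_le_succ fun n => ?_
    rintro ω ⟨k, hk, hak⟩
    refine ⟨2 * k, by rw [pow_succ]; lia, ?_⟩
    have : ((2 * k : ℕ) : ℝ≥0) * (T / 2 ^ (n + 1)) = k * (T / 2 ^ n) := by
      push_cast
      field_simp
      ring
    rwa [this]
  have hGle : ∀ n, P (G n) ≤ ENNReal.ofReal (Real.exp (-(a ^ 2 / (2 * T)))) := by
    intro n
    -- The exponent `T l ^ 2 / 2 - l a` is minimal at `l = a / T`.
    refine (measure_grid_le hB.toIsPreBrownianReal hadp hind (l := a / T) (by positivity) a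
      (g := fun k => k * (T / 2 ^ n))
      (fun i j hij => by dsimp only; gcongr) (2 ^ n)).trans (le_of_eq ?_)
    congr 2
    push_cast
    field_simp
    ring
  have hsub : {ω | ∃ t ≤ T, a < B t ω} ≤ᵐ[P] ⋃ n, G n := by
    filter_upwards [hB.cont] with ω hc hω
    obtain ⟨t, htT, hat⟩ := hω
    have htT' : (t : ℝ) / T ≤ 1 := (div_le_one hT').2 (by exact_mod_cast htT)
    have h1 : Tendsto (fun n : ℕ => (⌊(t : ℝ) / T * 2 ^ n⌋₊ : ℝ) / 2 ^ n) atTop (𝓝 ((t : ℝ) / T)) :=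
      (tendsto_nat_floor_mul_div_atTop (by positivity)).comp
        (tendsto_pow_atTop_atTop_of_one_lt one_lt_two)
    have h2 : Tendsto (fun n : ℕ => (⌊(t : ℝ) / T * 2 ^ n⌋₊ : ℝ≥0) * (T / 2 ^ n)) atTop (𝓝 t) := by
      rw [← NNReal.tendsto_coe]
      have h3 := h1.mul_const (T : ℝ)
      rw [div_mul_cancel₀ _ hT'.ne'] at h3
      refine h3.congr fun n => ?_
      push_cast
      ring
    obtain ⟨n, hn⟩ := (((hc.tendsto t).comp h2).eventually (lt_mem_nhds hat)).exists
    refine Set.mem_iUnion.2 ⟨n, _, ?_, hn⟩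
    have h4 : (t : ℝ) / T * 2 ^ n ≤ ((2 ^ n : ℕ) : ℝ) := by
      push_cast
      exact mul_le_of_le_one_left (by positivity) htT'
    exact Nat.floor_le_of_le h4
  refine (measure_mono_ae hsub).trans ?_
  rw [hGmono.measure_iUnion]
  exact iSup_le hGle

end Brownian

/-- Gaussian tail bound for the maximal norm of a `d`-dimensional Brownian motion. -/
lemma IsBrownianMotion.measure_exists_lt_norm_le {Ω : Type*} {mΩ : MeasurableSpace Ω} {d : ℕ}
    {𝓕 : Filtration ℝ≥0 mΩ} {P : Measure Ω} [IsProbabilityMeasure P] {W : ℝ≥0 → Ω → State d}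
    (hW : IsBrownianMotion 𝓕 P W) (hd : 0 < d) {T : ℝ≥0} (hT : 0 < T) {a : ℝ} (ha : 0 ≤ a) :
    P {ω | ∃ t ≤ T, a < ‖W t ω‖} ≤
      ENNReal.ofReal (2 * d * Real.exp (-((a / d) ^ 2 / (2 * T)))) := by
  set e := ENNReal.ofReal (Real.exp (-((a / d) ^ 2 / (2 * T)))) with he
  have hadp : ∀ i t, Measurable[𝓕 t] fun ω => W t ω i := fun i t =>
    (EuclideanSpace.proj (𝕜 := ℝ) i).continuous.measurable.comp (hW.adapted t)
  have hind : ∀ (i : Fin d) (f : ℝ → ℝ), Measurable f → ∀ s t : ℝ≥0, s ≤ t →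
      Indep (MeasurableSpace.comap (fun ω => f (W t ω i - W s ω i)) inferInstance) (𝓕 s) P := by
    intro i f hf s t hst
    refine indep_of_indep_of_le_left (hW.indep_increments s t hst) ?_
    have : (fun ω => f (W t ω i - W s ω i)) = (fun y : State d => f (y i)) ∘
        fun ω => W t ω - W s ω := by
      ext ω
      simp
    rw [this, ← MeasurableSpace.comap_comp]
    exact MeasurableSpace.comap_mono
      (hf.comp (EuclideanSpace.proj (𝕜 := ℝ) i).continuous.measurable).comap_le
  have hpos : ∀ i, P {ω | ∃ t ≤ T, a / d < W t ω i} ≤ e := fun i =>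
    measure_exists_lt_le (hW.component i) (hadp i) (hind i id measurable_id) hT (by positivity)
  have hneg : ∀ i, P {ω | ∃ t ≤ T, a / d < -W t ω i} ≤ e := fun i => by
    refine measure_exists_lt_le (hW.component i).neg (fun t => (hadp i t).neg) ?_ hT (by positivity)
    intro s t hst
    have h := hind i (fun y => -y) measurable_neg s t hst
    have heq : (fun ω => -(W t ω i - W s ω i)) = fun ω => -W t ω i - -W s ω i := by
      ext ω
      ring
    rwa [heq] at h
  have hsub : {ω | ∃ t ≤ T, a < ‖W t ω‖} ⊆
      ⋃ i, ({ω | ∃ t ≤ T, a / d < W t ω i} ∪ {ω | ∃ t ≤ T, a / d < -W t ω i}) := by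
    rintro ω ⟨t, ht, hat⟩
    by_contra hcon
    simp only [Set.mem_iUnion, Set.mem_union, Set.mem_ofPred_eq, not_exists, not_or, not_and,
      not_lt] at hcon
    have hd' : (0 : ℝ) < d := by exact_mod_cast hd
    have := norm_le_of_abs_apply_le (U := W t ω) (c := a / d) fun i =>
      abs_le'.2 ⟨(hcon i).1 t ht, (hcon i).2 t ht⟩
    rw [mul_div_cancel₀ _ hd'.ne'] at this
    linarith
  calc P {ω | ∃ t ≤ T, a < ‖W t ω‖}
      ≤ ∑ i, P ({ω | ∃ t ≤ T, a / d < W t ω i} ∪ {ω | ∃ t ≤ T, a / d < -W t ω i}) :=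
        (measure_mono hsub).trans (measure_iUnion_fintype_le _ _)
    _ ≤ ∑ _i : Fin d, (e + e) := Finset.sum_le_sum fun i _ =>
        (measure_union_le _ _).trans (add_le_add (hpos i) (hneg i))
    _ = _ := by
        rw [Finset.sum_const, Finset.card_univ, Fintype.card_fin, nsmul_eq_mul, ← two_mul,
          ENNReal.ofReal_mul (by positivity), ENNReal.ofReal_mul (by norm_num), he]
        simp
        ring

/-! ### Exponentially fast convergence of the explosion times -/

/-- The explosion time of the stochastic equation deviates from the deterministic one with
exponentially small probability, uniformly over compact sets of exploding initial data. -/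
theorem exists_real_timeDist_le {d : ℕ} (hd : 2 ≤ d) {p h : ℝ} (hp : 1 < p) (hh : 0 < h)
    {K : Set (State d)} (hK : IsCompact K) (hKD : K ⊆ explosionDomain (drift d p h))
    {δ : ℝ} (hδ : 0 < δ) :
    ∃ C₁ C₂ : ℝ, 0 < C₁ ∧ 0 < C₂ ∧ ∀ ε : ℝ, 0 < ε → ∀ u ∈ K, ∀ x : ℝ≥0 → OnePoint (State d),
      IsODESolution (drift d p h) u x →
      ∀ (Ω : Type*) (mΩ : MeasurableSpace Ω) (P : Measure Ω) (𝓕 : Filtration ℝ≥0 mΩ)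
        (W : ℝ≥0 → Ω → State d) (X : ℝ≥0 → Ω → OnePoint (State d)),
        IsProbabilityMeasure P → IsSDESolution (drift d p h) ε u 𝓕 P W X →
        P.real {ω | ENNReal.ofReal δ <
            timeDist (explosionTime fun t => X t ω) (explosionTime x)}
          ≤ C₁ * Real.exp (-C₂ / ε ^ 2) := by
  obtain ⟨ρ, hρ, T, H⟩ := exists_timeDist_le_of_isCompact hd hp hh hK hKD hδ
  have hd0 : (0 : ℝ) < d := by exact_mod_cast (by lia : 0 < d)
  refine ⟨2 * d, (ρ / d) ^ 2 / (2 * (T + 1)), by positivity, by positivity, ?_⟩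
  intro ε hε u hu x hx Ω mΩ P 𝓕 W X hP hX
  have hsub : {ω | ENNReal.ofReal δ < timeDist (explosionTime fun t => X t ω) (explosionTime x)}
      ≤ᵐ[P] {ω | ∃ t ≤ T + 1, ρ / ε < ‖W t ω‖} := by
    filter_upwards [hX.ae_isPerturbedSolution (continuous_drift hp hh)] with ω hω hdist
    by_contra hcon
    refine absurd (show ENNReal.ofReal δ < _ from hdist)
      (not_lt.2 (H u hu _ x _ hx hω fun t ht => ?_))
    have : ‖W t ω‖ ≤ ρ / ε := not_lt.1 fun hlt => hcon ⟨t, ht.trans le_self_add, hlt⟩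
    rw [norm_smul, Real.norm_eq_abs, abs_of_pos hε, mul_comm]
    exact (le_div_iff₀ hε).1 this
  have hmeas := (measure_mono_ae hsub).trans (hX.brownian.measure_exists_lt_norm_le
    (by lia) (T := T + 1) (by positivity) (by positivity : 0 ≤ ρ / ε))
  refine (ENNReal.toReal_le_of_le_ofReal (by positivity) hmeas).trans (le_of_eq ?_)
  congr 2
  push_cast
  field_simp

end BlowUp

theorem theorem2p4 (d : ℕ) (hd : 2 ≤ d) (p h : ℝ) (hp : 1 < p) (hh : 0 < h) :
    -- convergence in probability
    (∀ u ∈ BlowUp.explosionDomain (BlowUp.drift d p h),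
      ∀ x : ℝ≥0 → OnePoint (BlowUp.State d), BlowUp.IsODESolution (BlowUp.drift d p h) u x →
      ∀ δ : ℝ, 0 < δ →
      ∀ (Ω : ℝ → Type*) (mΩ : ∀ ε, MeasurableSpace (Ω ε)) (P : ∀ ε, Measure (Ω ε))
        (𝓕 : ∀ ε, Filtration ℝ≥0 (mΩ ε)) (W : ∀ ε, ℝ≥0 → Ω ε → BlowUp.State d)
        (X : ∀ ε, ℝ≥0 → Ω ε → OnePoint (BlowUp.State d)),
        (∀ ε, 0 < ε → IsProbabilityMeasure (P ε)) →
        (∀ ε, 0 < ε →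
          BlowUp.IsSDESolution (BlowUp.drift d p h) ε u (𝓕 ε) (P ε) (W ε) (X ε)) →
        Tendsto (fun ε : ℝ => (P ε).real {ω | ENNReal.ofReal δ <
            BlowUp.timeDist (BlowUp.explosionTime fun t => X ε t ω) (BlowUp.explosionTime x)})
          (𝓝[>] 0) (𝓝 0)) ∧
    -- the convergence is exponentially fast
    (∀ u ∈ BlowUp.explosionDomain (BlowUp.drift d p h),
      ∀ x : ℝ≥0 → OnePoint (BlowUp.State d), BlowUp.IsODESolution (BlowUp.drift d p h) u x →
      ∀ δ : ℝ, 0 < δ → ∃ C₁ C₂ : ℝ, 0 < C₁ ∧ 0 < C₂ ∧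
      ∀ ε : ℝ, 0 < ε → ε ≤ 1 →
      ∀ (Ω : Type*) (mΩ : MeasurableSpace Ω) (P : Measure Ω) (𝓕 : Filtration ℝ≥0 mΩ)
        (W : ℝ≥0 → Ω → BlowUp.State d) (X : ℝ≥0 → Ω → OnePoint (BlowUp.State d)),
        IsProbabilityMeasure P →
        BlowUp.IsSDESolution (BlowUp.drift d p h) ε u 𝓕 P W X →
        P.real {ω | ENNReal.ofReal δ <
            BlowUp.timeDist (BlowUp.explosionTime fun t => X t ω) (BlowUp.explosionTime x)}
          ≤ C₁ * Real.exp (-C₂ / ε ^ 2)) ∧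
    -- the upper bound is uniform on compact subsets of the domain of explosion
    (∀ K : Set (BlowUp.State d), IsCompact K →
      K ⊆ BlowUp.explosionDomain (BlowUp.drift d p h) →
      ∀ δ : ℝ, 0 < δ → ∃ C₁ C₂ : ℝ, 0 < C₁ ∧ 0 < C₂ ∧
      ∀ ε : ℝ, 0 < ε → ε ≤ 1 →
      ∀ u ∈ K, ∀ x : ℝ≥0 → OnePoint (BlowUp.State d),
      BlowUp.IsODESolution (BlowUp.drift d p h) u x →
      ∀ (Ω : Type*) (mΩ : MeasurableSpace Ω) (P : Measure Ω) (𝓕 : Filtration ℝ≥0 mΩ)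
        (W : ℝ≥0 → Ω → BlowUp.State d) (X : ℝ≥0 → Ω → OnePoint (BlowUp.State d)),
        IsProbabilityMeasure P →
        BlowUp.IsSDESolution (BlowUp.drift d p h) ε u 𝓕 P W X →
        P.real {ω | BlowUp.explosionTime x + ENNReal.ofReal δ <
            BlowUp.explosionTime fun t => X t ω}
          ≤ C₁ * Real.exp (-C₂ / ε ^ 2)) := by
  refine ⟨?_, ?_, ?_⟩
  · intro u hu x hx δ hδ Ω mΩ P 𝓕 W X hP hX
    obtain ⟨C₁, C₂, -, hC₂, H⟩ := BlowUp.exists_real_timeDist_le hd hp hh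
      (isCompact_singleton (x := u)) (Set.singleton_subset_iff.2 hu) hδ
    have hlim : Tendsto (fun ε : ℝ => C₁ * Real.exp (-C₂ / ε ^ 2)) (𝓝[>] 0) (𝓝 0) := by
      have h1 : Tendsto (fun ε : ℝ => C₂ * (ε⁻¹) ^ 2) (𝓝[>] 0) atTop :=
        ((tendsto_pow_atTop two_ne_zero).comp tendsto_inv_nhdsGT_zero).const_mul_atTop hC₂
      have h2 := (Real.tendsto_exp_neg_atTop_nhds_zero.comp h1).const_mul C₁
      rw [mul_zero] at h2
      refine h2.congr fun ε => ?_
      simp only [Function.comp_apply]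
      congr 2
      rw [inv_pow, neg_div, div_eq_mul_inv]
    refine tendsto_of_tendsto_of_tendsto_of_le_of_le' tendsto_const_nhds hlim
      (.of_forall fun ε => measureReal_nonneg) ?_
    filter_upwards [self_mem_nhdsWithin] with ε hε
    exact H ε hε u rfl x hx (Ω ε) (mΩ ε) (P ε) (𝓕 ε) (W ε) (X ε) (hP ε hε) (hX ε hε)
  · intro u hu x hx δ hδ
    obtain ⟨C₁, C₂, hC₁, hC₂, H⟩ := BlowUp.exists_real_timeDist_le hd hp hh
      (isCompact_singleton (x := u)) (Set.singleton_subset_iff.2 hu) hδ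
    exact ⟨C₁, C₂, hC₁, hC₂, fun ε hε _ => H ε hε u rfl x hx⟩
  · intro K hK hKD δ hδ
    obtain ⟨C₁, C₂, hC₁, hC₂, H⟩ := BlowUp.exists_real_timeDist_le hd hp hh hK hKD hδ
    refine ⟨C₁, C₂, hC₁, hC₂, fun ε hε _ u hu x hx Ω mΩ P 𝓕 W X hP hX => ?_⟩
    refine le_trans (measureReal_mono fun ω hω => ?_) (H ε hε u hu x hx Ω mΩ P 𝓕 W X hP hX)
    rw [Set.mem_ofPred_eq] at hω
    exact lt_max_of_lt_left (lt_tsub_iff_left.2 hω)
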